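/- Let $d\in\mathbb N$, and let $\omega:[0,\infty)\to[0,\infty)$ be a continuous increasing (i.e. non-decreasing) function such that: ($\alpha$) there is $L\ge1$ with $\omega(2t)\le L(\omega(t)+1)$ for all $t\ge0$; ($\beta$) $\int_1^{\infty}\omega(t)t^{-2}\,dt<\infty$; ($\gamma$) there are $a\in\mathbb R$ and $b>0$ with $\omega(t)\ge a+b\log(1+t)$ for all $t\ge0$; ($\delta$) $t\mapsto\omega(e^t)$ is convex on $\mathbb R$. For $x\in\mathbb R^d$ write $\omega(x):=\omega(|x|)$, where $|x|$ is the Euclidean norm, and let $|x|_\infty$ be the sup norm. Put $\hat u(\xi):=\int_{\mathbb R^d}u(x)e^{-i\langle x,\xi\rangle}\,dx$, and let $D^\alpha=D_1^{\alpha_1}\cdots D_d^{\alpha_d}$ with $D_j=-i\partial_{x_j}$. Let $\mathcal S_\omega(\mathbb R^d)$ be the set of all $u\in L^1(\mathbb R^d)$ such that $u,\hat u\in C^\infty(\mathbb R^d)$ and, for all $\lambda>0$ and all multi-indices $\alpha\in\mathbb N_0^d$, $$\sup_{x\in\mathbb R^d}e^{\lambda\omega(x)}|D^\alpha u(x)|<\infty,\qquad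 \sup_{\xi\in\mathbb R^d}e^{\lambda\omega(\xi)}|D^\alpha\hat u(\xi)|<\infty.$$ Define the Wigner transform by $$\operatorname{Wig}f(x,\xi):=\int_{\mathbb R^d}f\left(x+\tfrac t2\right)\overline{f\left(x-\tfrac t2\right)}\,e^{-i\langle\xi,t\rangle}\,dt,\qquad x,\xi\in\mathbb R^d,$$ the mixed norm of a measurable function $F$ on $\mathbb R^{2d}$ by $$\|F\|_{L^{p,q}}:=\Big(\int_{\mathbb R^d}\Big(\int_{\mathbb R^d}|F(x,\xi)|^p\,dx\Big)^{q/p}d\xi\Big)^{1/q}\in[0,\infty]$$ (with the $L^p$ or $L^q$ norm replaced by the essential supremum if $p=\infty$ or $q=\infty$), and, for a function $g$ on $\mathbb R^d$, $$R_g:=\sup\{|x|_\infty:\ x\in\operatorname{supp}g\}\in[0,\infty],$$ where $\operatorname{supp}g$ is the closure of $\{g\neq0\}$ and $\sup\emptyset:=0$. Let $f\in\mathcal S_\omega(\mathbb R^d)$ and $p,q\in[1,\infty]$. Then, for all $\lambda,\mu\ge0$, the following limit exists in $[0,\infty]$ and $$\lim_{N\to+\infty}\left\|e^{\lambda\omega\left(\frac{x}{N+1}\right)+\mu\omega(\xi)}\,|\xi|_\infty^N\,\operatorname{Wig}f(x,\xi)\right\|_{L^{p,q}}^{1/N}=R_{\hat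 f}.$$ -/

import Mathlib

open MeasureTheory Filter Topology
open scoped ENNReal

noncomputable section

namespace PaleyWienerWigner

/-- Non-quasianalytic weight functions `ω : [0, ∞) → [0, ∞)`. The function is represented by a
function on `ℝ`, and only its values on `[0, ∞)` are constrained and used. -/
structure IsNonQuasianalyticWeight (ω : ℝ → ℝ) : Prop where
  continuousOn : ContinuousOn ω (Set.Ici 0)
  monotoneOn : MonotoneOn ω (Set.Ici 0)
  nonneg : ∀ t, 0 ≤ t → 0 ≤ ω t
  alpha : ∃ L : ℝ, 1 ≤ L ∧ ∀ t, 0 ≤ t → ω (2 * t) ≤ L * (ω t + 1)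
  beta : IntegrableOn (fun t : ℝ => ω t / t ^ 2) (Set.Ioi 1) volume
  gamma : ∃ a b : ℝ, 0 < b ∧ ∀ t, 0 ≤ t → a + b * Real.log (1 + t) ≤ ω t
  delta : ConvexOn ℝ Set.univ (fun t : ℝ => ω (Real.exp t))

variable {d : ℕ}

/-- The sup norm `|x|_∞` of a vector of `ℝ^d` (while `‖x‖` is its Euclidean norm). -/
def supNorm (x : EuclideanSpace ℝ (Fin d)) : ℝ := ‖WithLp.ofLp x‖

/-- The operator `D_j = -i ∂_j`. -/
def Dpartial (j : Fin d) (g : EuclideanSpace ℝ (Fin d) → ℂ) : EuclideanSpace ℝ (Fin d) → ℂ :=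
  fun x => -Complex.I * fderiv ℝ g x (EuclideanSpace.single j (1 : ℝ))

/-- The operator `D^α = D_1^{α_1} ⋯ D_d^{α_d}` for a multi-index `α`. -/
def Dmulti (α : Fin d → ℕ) (g : EuclideanSpace ℝ (Fin d) → ℂ) : EuclideanSpace ℝ (Fin d) → ℂ :=
  (List.finRange d).foldr (fun j h => (Dpartial j)^[α j] h) g

/-- The Fourier transform `û(ξ) = ∫ u(x) e^{-i⟨x,ξ⟩} dx`. -/
def fourierHat (u : EuclideanSpace ℝ (Fin d) → ℂ) (ξ : EuclideanSpace ℝ (Fin d)) : ℂ :=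
  ∫ x, u x * Complex.exp (-Complex.I * ((inner ℝ x ξ : ℝ) : ℂ))

/-- The cross-Wigner transform
`Wig(u,v)(x,ξ) = ∫ u(x + t/2) conj(v(x - t/2)) e^{-i⟨ξ,t⟩} dt`. -/
def crossWigner (u v : EuclideanSpace ℝ (Fin d) → ℂ) (x ξ : EuclideanSpace ℝ (Fin d)) : ℂ :=
  ∫ t, u (x + (1 / 2 : ℝ) • t) * (starRingEnd ℂ) (v (x - (1 / 2 : ℝ) • t)) *
    Complex.exp (-Complex.I * ((inner ℝ ξ t : ℝ) : ℂ))

/-- `Wig u = Wig(u,u)`. -/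
def wigner (u : EuclideanSpace ℝ (Fin d) → ℂ) (x ξ : EuclideanSpace ℝ (Fin d)) : ℂ :=
  crossWigner u u x ξ

/-- Membership in `𝒮_ω(ℝ^d)`; here `ω(x)` stands for `ω(|x|)`, with the Euclidean norm. -/
structure MemSomega (ω : ℝ → ℝ) (u : EuclideanSpace ℝ (Fin d) → ℂ) : Prop where
  integrable : Integrable u volume
  smooth : ContDiff ℝ (⊤ : ℕ∞) u
  smooth_hat : ContDiff ℝ (⊤ : ℕ∞) (fourierHat u)
  decay : ∀ lam : ℝ, 0 < lam → ∀ α : Fin d → ℕ,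
    ∃ C : ℝ, ∀ x, Real.exp (lam * ω ‖x‖) * ‖Dmulti α u x‖ ≤ C
  decay_hat : ∀ lam : ℝ, 0 < lam → ∀ α : Fin d → ℕ,
    ∃ C : ℝ, ∀ ξ, Real.exp (lam * ω ‖ξ‖) * ‖Dmulti α (fourierHat u) ξ‖ ≤ C

/-- The mixed norm `‖F‖_{L^{p,q}} ∈ [0, ∞]`: the `L^p` norm in the first variable `x`, followed by
the `L^q` norm in the second variable `ξ` (essential suprema for infinite exponents). -/
def mixedNorm (p q : ℝ≥0∞)
    (F : EuclideanSpace ℝ (Fin d) → EuclideanSpace ℝ (Fin d) → ℂ) : ℝ≥0∞ :=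
  eLpNorm (fun ξ => eLpNorm (fun x => F x ξ) p volume) q volume

/-- `R_g = sup {|x|_∞ : x ∈ supp g} ∈ [0, ∞]`; it is `0` if `g = 0`. -/
def supportRadius (g : EuclideanSpace ℝ (Fin d) → ℂ) : ℝ≥0∞ :=
  ⨆ x ∈ tsupport g, ENNReal.ofReal (supNorm x)

end PaleyWienerWigner

end

/-!
The proof traps the mixed norm between two geometric sequences, `c ^ N * K` for every `c < R` and
`R ^ N * K'` when `R < ∞`, where `R` is the support radius of the Fourier transform of `f`; the
constants disappear under `N`-th roots (`tendsto_rpow_one_div_of_bounds`).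

The link between the Wigner transform and the Fourier transform of `f` is a convolution: up to a
nonvanishing factor, `Wig f (x, ξ)` is the value at `2x` of the convolution of `f e^{-2i⟨·, ξ⟩}` with
the conjugate of `f`, whose Fourier transform is a product of translates of `f̂` and its conjugate.
Hence if `Wig f (·, ξ)` is not identically zero, `ξ` is the midpoint of two points where `f̂ ≠ 0`, so
`|ξ|_∞ ≤ R` (`exists_midpoint_of_wigner_ne_zero`), while `f̂ ξ ≠ 0` forces `Wig f (·, ξ)` to be
nonzero somewhere (`exists_wigner_ne_zero`).

For the upper bound, the decay of `f` together with the logarithmic lower bound for `ω` gives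
`e^{λ ω(x)} |Wig f (x, ξ)| ≤ C (1 + |x|)^{-(d+1)}` uniformly in `ξ`
(`MemSomega.exists_decay_wigner`). As `ω(x/(N+1)) ≤ ω(x)` and `ξ` stays in a bounded set, all
weights except `|ξ|_∞ ^ N ≤ R ^ N` are bounded independently of `N`. For the lower bound, all
exponential weights are at least `1`, and by continuity `|Wig f|` is bounded below on a nonempty
open box contained in `{|ξ|_∞ > c}`.
-/

namespace PaleyWienerWigner

variable {d : ℕ}

/-! ### Decay and continuity of the Wigner transform -/

lemma Dmulti_zero (g : EuclideanSpace ℝ (Fin d) → ℂ) : Dmulti 0 g = g := by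
  unfold Dmulti
  induction List.finRange d with
  | nil => rfl
  | cons j l ih => simp

lemma norm_wignerIntegrand (f : EuclideanSpace ℝ (Fin d) → ℂ) (x ξ t : EuclideanSpace ℝ (Fin d)) :
    ‖f (x + (1 / 2 : ℝ) • t) * (starRingEnd ℂ) (f (x - (1 / 2 : ℝ) • t)) *
      Complex.exp (-Complex.I * ((inner ℝ ξ t : ℝ) : ℂ))‖
      = ‖f (x + (1 / 2 : ℝ) • t)‖ * ‖f (x - (1 / 2 : ℝ) • t)‖ := by
  simp [Complex.norm_exp]

/-- The larger of `|x + t/2|` and `|x - t/2|` dominates both `|x|` and `|t|/2`, so the decay of one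
factor of the integrand of the Wigner transform yields decay in `x` and in `t` at once. -/
lemma MemSomega.exists_decay_mul {ω : ℝ → ℝ} (hω : IsNonQuasianalyticWeight ω)
    {f : EuclideanSpace ℝ (Fin d) → ℂ} (hf : MemSomega ω f) {lam k : ℝ} (hlam : 0 ≤ lam)
    (hk : 0 < k) :
    ∃ C : ℝ, 0 ≤ C ∧ ∀ x t : EuclideanSpace ℝ (Fin d),
      Real.exp (lam * ω ‖x‖) * (‖f (x + (1 / 2 : ℝ) • t)‖ * ‖f (x - (1 / 2 : ℝ) • t)‖) ≤
        C * (1 + ‖x‖) ^ (-k) * (1 + ‖t‖) ^ (-k) := by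
  obtain ⟨a, b, hb, hab⟩ := hω.gamma
  -- `κ` is chosen so that `exp (κ * ω s)` dominates a multiple of `(1 + s) ^ (2 * k)`.
  set κ := 2 * k / b with hκ
  have hκ0 : 0 < κ := by positivity
  obtain ⟨C, hC⟩ := hf.decay (lam + κ) (by positivity) 0
  rw [Dmulti_zero] at hC
  have hC0 : 0 ≤ C := le_trans (by positivity) (hC 0)
  have hbd (y) : ‖f y‖ ≤ C := by
    refine le_trans ?_ (hC y)
    have : 1 ≤ Real.exp ((lam + κ) * ω ‖y‖) :=
      Real.one_le_exp (mul_nonneg (by positivity) (hω.nonneg _ (norm_nonneg y)))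
    nlinarith [norm_nonneg (f y)]
  have key : ∀ x t y z : EuclideanSpace ℝ (Fin d), ‖x‖ ≤ ‖y‖ → ‖t‖ ≤ 2 * ‖y‖ →
      Real.exp (lam * ω ‖x‖) * (‖f y‖ * ‖f z‖) ≤
        (2 ^ k * Real.exp (-(κ * a)) * C ^ 2) * (1 + ‖x‖) ^ (-k) * (1 + ‖t‖) ^ (-k) := by
    intro x t y z hx ht
    have h1 : Real.exp (lam * ω ‖x‖) ≤ Real.exp (lam * ω ‖y‖) :=
      Real.exp_le_exp.2 (mul_le_mul_of_nonneg_left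
        (hω.monotoneOn (norm_nonneg x) (norm_nonneg y) hx) hlam)
    have h2 : Real.exp (κ * a) * ((1 + ‖x‖) ^ k * ((1 + ‖t‖) / 2) ^ k) ≤
        Real.exp (κ * ω ‖y‖) := by
      calc Real.exp (κ * a) * ((1 + ‖x‖) ^ k * ((1 + ‖t‖) / 2) ^ k)
          ≤ Real.exp (κ * a) * ((1 + ‖y‖) ^ k * (1 + ‖y‖) ^ k) := by
            gcongr
            linarith
        _ = Real.exp (κ * (a + b * Real.log (1 + ‖y‖))) := by
            rw [Real.rpow_def_of_pos (by positivity), ← Real.exp_add, ← Real.exp_add]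
            congr 1
            rw [hκ]
            field_simp
            ring
        _ ≤ _ := Real.exp_le_exp.2 (mul_le_mul_of_nonneg_left (hab _ (norm_nonneg y)) hκ0.le)
    have h3 := hC y
    rw [add_mul, Real.exp_add] at h3
    rw [Real.rpow_neg (by positivity), Real.rpow_neg (by positivity), Real.exp_neg]
    rw [Real.div_rpow (by positivity) (by positivity)] at h2
    have hX : 0 < (1 + ‖x‖) ^ k := by positivity
    have hT : 0 < (1 + ‖t‖) ^ k := by positivity
    have h2k : (0 : ℝ) < 2 ^ k := by positivity
    have hE := Real.exp_pos (κ * a)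
    have hgoal : Real.exp (lam * ω ‖x‖) * (‖f y‖ * ‖f z‖) *
        (Real.exp (κ * a) * ((1 + ‖x‖) ^ k * ((1 + ‖t‖) ^ k / 2 ^ k))) ≤ C ^ 2 := by
      calc _ ≤ Real.exp (lam * ω ‖y‖) * (‖f y‖ * C) * Real.exp (κ * ω ‖y‖) := by
            gcongr
            exact hbd z
        _ = (Real.exp (lam * ω ‖y‖) * Real.exp (κ * ω ‖y‖) * ‖f y‖) * C := by ring
        _ ≤ C * C := by gcongr
        _ = C ^ 2 := by ring
    calc _ ≤ C ^ 2 / (Real.exp (κ * a) * ((1 + ‖x‖) ^ k * ((1 + ‖t‖) ^ k / 2 ^ k))) := by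
          rw [le_div_iff₀ (by positivity)]
          exact hgoal
      _ = _ := by field_simp
  refine ⟨2 ^ k * Real.exp (-(κ * a)) * C ^ 2, by positivity, fun x t => ?_⟩
  set y := x + (1 / 2 : ℝ) • t with hy
  set z := x - (1 / 2 : ℝ) • t with hz
  have hx2 : ‖x‖ ≤ (‖y‖ + ‖z‖) / 2 := by
    have : x = (1 / 2 : ℝ) • (y + z) := by rw [hy, hz]; module
    calc ‖x‖ = 1 / 2 * ‖y + z‖ := by rw [this, norm_smul]; norm_num
      _ ≤ _ := by linarith [norm_add_le y z]
  have ht2 : ‖t‖ ≤ ‖y‖ + ‖z‖ := by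
    have : t = y - z := by rw [hy, hz]; module
    rw [this]
    exact norm_sub_le y z
  rcases le_total ‖z‖ ‖y‖ with h | h
  · exact key x t y z (by linarith) (by linarith)
  · rw [mul_comm ‖f y‖]
    exact key x t z y (by linarith) (by linarith)

lemma integrable_one_add_norm_rpow :
    Integrable (fun t : EuclideanSpace ℝ (Fin d) => (1 + ‖t‖) ^ (-((d : ℝ) + 1))) :=
  integrable_one_add_norm (by simp)

lemma MemSomega.continuous_wigner {ω : ℝ → ℝ} (hω : IsNonQuasianalyticWeight ω)
    {f : EuclideanSpace ℝ (Fin d) → ℂ} (hf : MemSomega ω f) :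
    Continuous (fun z : EuclideanSpace ℝ (Fin d) × EuclideanSpace ℝ (Fin d) =>
      wigner f z.1 z.2) := by
  have hk : (0 : ℝ) < (d : ℝ) + 1 := by positivity
  obtain ⟨C, hC0, hC⟩ := hf.exists_decay_mul hω le_rfl hk
  have hfc := hf.smooth.continuous
  unfold wigner crossWigner
  refine continuous_of_dominated (bound := fun t => C * (1 + ‖t‖) ^ (-((d : ℝ) + 1)))
    (fun z => ?_) (fun z => ae_of_all _ fun t => ?_) (integrable_one_add_norm_rpow.const_mul C)
    (ae_of_all _ fun t => ?_)
  · exact Continuous.aestronglyMeasurable (by fun_prop)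
  · rw [norm_wignerIntegrand]
    have h := hC z.1 t
    rw [zero_mul, Real.exp_zero, one_mul] at h
    refine h.trans ?_
    have h1 : (1 + ‖z.1‖) ^ (-((d : ℝ) + 1)) ≤ 1 :=
      Real.rpow_le_one_of_one_le_of_nonpos (by linarith [norm_nonneg z.1]) (by linarith)
    gcongr
    exact mul_le_of_le_one_right hC0 h1
  · fun_prop

lemma MemSomega.exists_decay_wigner {ω : ℝ → ℝ} (hω : IsNonQuasianalyticWeight ω)
    {f : EuclideanSpace ℝ (Fin d) → ℂ} (hf : MemSomega ω f) {lam : ℝ} (hlam : 0 ≤ lam) :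
    ∃ C : ℝ, 0 ≤ C ∧ ∀ x ξ : EuclideanSpace ℝ (Fin d),
      Real.exp (lam * ω ‖x‖) * ‖wigner f x ξ‖ ≤ C * (1 + ‖x‖) ^ (-((d : ℝ) + 1)) := by
  have hk : (0 : ℝ) < (d : ℝ) + 1 := by positivity
  obtain ⟨C, hC0, hC⟩ := hf.exists_decay_mul hω hlam hk
  refine ⟨C * ∫ t : EuclideanSpace ℝ (Fin d), (1 + ‖t‖) ^ (-((d : ℝ) + 1)),
    mul_nonneg hC0 (integral_nonneg fun t => by positivity), fun x ξ => ?_⟩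
  have hE := Real.exp_pos (lam * ω ‖x‖)
  have h : ‖wigner f x ξ‖ ≤ ∫ t : EuclideanSpace ℝ (Fin d),
      (Real.exp (lam * ω ‖x‖))⁻¹ * (C * (1 + ‖x‖) ^ (-((d : ℝ) + 1))) *
        (1 + ‖t‖) ^ (-((d : ℝ) + 1)) := by
    refine norm_integral_le_of_norm_le (integrable_one_add_norm_rpow.const_mul _)
      (ae_of_all _ fun t => ?_)
    rw [norm_wignerIntegrand, mul_assoc, le_inv_mul_iff₀ hE]
    exact hC x t
  rw [integral_const_mul, mul_assoc, le_inv_mul_iff₀ hE] at h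
  linarith

/-! ### The Wigner transform and the support of the Fourier transform -/

lemma fourierHat_eq_fourier (u : EuclideanSpace ℝ (Fin d) → ℂ) (η ξ : EuclideanSpace ℝ (Fin d)) :
    FourierTransform.fourier
      (fun y => u y * Complex.exp (-Complex.I * ((inner ℝ y ξ : ℝ) : ℂ))) η =
      fourierHat u ((2 * Real.pi) • η + ξ) := by
  rw [Real.fourier_eq', fourierHat]
  congr 1
  ext y
  rw [inner_add_right, inner_smul_right, smul_eq_mul, mul_left_comm, ← Complex.exp_add]
  congr 2
  push_cast
  ring

lemma fourierHat_conj_eq_fourier (u : EuclideanSpace ℝ (Fin d) → ℂ)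
    (η : EuclideanSpace ℝ (Fin d)) :
    FourierTransform.fourier (fun y => (starRingEnd ℂ) (u y)) η =
      (starRingEnd ℂ) (fourierHat u (-((2 * Real.pi) • η))) := by
  rw [Real.fourier_eq', fourierHat, ← integral_conj]
  congr 1
  ext y
  rw [inner_neg_right, inner_smul_right, smul_eq_mul, mul_comm, map_mul, ← Complex.exp_conj]
  congr 2
  simp [map_ofNat]
  ring

/-- The function whose convolution with the conjugate of `f` is, up to a nonvanishing factor, the
section of the Wigner transform at frequency `ξ`. -/
noncomputable def modulated (f : EuclideanSpace ℝ (Fin d) → ℂ) (ξ : EuclideanSpace ℝ (Fin d)) :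
    EuclideanSpace ℝ (Fin d) → ℂ :=
  fun y => f y * Complex.exp (-Complex.I * ((inner ℝ y ((2 : ℝ) • ξ) : ℝ) : ℂ))

/-- The convolution of `modulated f ξ` with the conjugate of `f`. -/
noncomputable def wignerConvolution (f : EuclideanSpace ℝ (Fin d) → ℂ) (ξ : EuclideanSpace ℝ (Fin d)) :
    EuclideanSpace ℝ (Fin d) → ℂ :=
  convolution (modulated f ξ) (fun y => (starRingEnd ℂ) (f y)) (ContinuousLinearMap.mul ℂ ℂ) volume

/-- The substitution `y = x + t/2` in the definition of the Wigner transform. -/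
lemma wignerConvolution_two_smul (f : EuclideanSpace ℝ (Fin d) → ℂ)
    (x ξ : EuclideanSpace ℝ (Fin d)) :
    wignerConvolution f ξ ((2 : ℝ) • x) =
      Complex.exp (-Complex.I * ((inner ℝ x ((2 : ℝ) • ξ) : ℝ) : ℂ)) *
        (|((2 : ℝ) ^ d)⁻¹| • wigner f x ξ) := by
  have h := Measure.integral_comp_smul volume (fun t : EuclideanSpace ℝ (Fin d) =>
    f (x + (1 / 2 : ℝ) • t) * (starRingEnd ℂ) (f (x - (1 / 2 : ℝ) • t)) *
      Complex.exp (-Complex.I * ((inner ℝ ξ t : ℝ) : ℂ))) 2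
  rw [finrank_euclideanSpace_fin] at h
  rw [wigner, crossWigner, ← h, ← integral_const_mul, wignerConvolution, convolution_def,
    ← integral_add_left_eq_self _ x]
  congr 1
  ext s
  have h1 : (2 : ℝ) • x - (x + s) = x - s := by module
  have h2 : (1 / 2 : ℝ) • (2 : ℝ) • s = s := by module
  simp only [ContinuousLinearMap.mul_apply', modulated]
  rw [h1, h2, inner_add_left, inner_smul_right s, inner_smul_right ξ, real_inner_comm ξ s,
    Complex.ofReal_add, mul_add, Complex.exp_add]
  ring

lemma integrable_modulated {f : EuclideanSpace ℝ (Fin d) → ℂ} (hi : Integrable f)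
    (ξ : EuclideanSpace ℝ (Fin d)) : Integrable (modulated f ξ) := by
  refine hi.mul_bdd (c := 1) (Continuous.aestronglyMeasurable (by fun_prop)) (ae_of_all _ fun y => ?_)
  simp [Complex.norm_exp]

lemma integrable_conj {f : EuclideanSpace ℝ (Fin d) → ℂ} (hi : Integrable f) :
    Integrable (fun y => (starRingEnd ℂ) (f y)) :=
  hi.mono (Complex.continuous_conj.comp_aestronglyMeasurable hi.aestronglyMeasurable)
    (ae_of_all _ fun y => by simp)

lemma fourier_wignerConvolution {f : EuclideanSpace ℝ (Fin d) → ℂ} (hi : Integrable f)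
    (ξ η : EuclideanSpace ℝ (Fin d)) :
    FourierTransform.fourier (wignerConvolution f ξ) η =
      fourierHat f ((2 * Real.pi) • η + (2 : ℝ) • ξ) *
        (starRingEnd ℂ) (fourierHat f (-((2 * Real.pi) • η))) := by
  rw [wignerConvolution, Real.fourier_mul_convolution_eq (integrable_modulated hi ξ)
    (integrable_conj hi), fourierHat_conj_eq_fourier]
  unfold modulated
  rw [fourierHat_eq_fourier]

lemma eq_zero_of_fourier_eq_zero {g : EuclideanSpace ℝ (Fin d) → ℂ} (hc : Continuous g)
    (hi : Integrable g) (h : FourierTransform.fourier g = 0) : g = 0 := by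
  rw [← hc.fourierInv_fourier_eq hi (by rw [h]; exact integrable_zero _ _ _), h]
  ext v
  simp [Real.fourierInv_eq']

/-- A frequency at which the Wigner transform does not vanish is the midpoint of two points at
which the Fourier transform does not vanish. -/
lemma exists_midpoint_of_wigner_ne_zero {f : EuclideanSpace ℝ (Fin d) → ℂ} (hi : Integrable f)
    (hc : Continuous f) {B : ℝ} (hB : ∀ y, ‖f y‖ ≤ B) {x ξ : EuclideanSpace ℝ (Fin d)}
    (h : wigner f x ξ ≠ 0) :
    ∃ a b, a + b = (2 : ℝ) • ξ ∧ fourierHat f a ≠ 0 ∧ fourierHat f b ≠ 0 := by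
  by_contra! hcon
  have hzero : wignerConvolution f ξ = 0 := by
    refine eq_zero_of_fourier_eq_zero ?_ ?_ ?_
    · refine BddAbove.continuous_convolution_right_of_integrable _ ⟨B, ?_⟩
        (integrable_modulated hi ξ) (by fun_prop)
      rintro _ ⟨y, rfl⟩
      simpa using hB y
    · exact (integrable_modulated hi ξ).integrable_convolution _ (integrable_conj hi)
    · ext η
      rw [fourier_wignerConvolution hi]
      by_cases ha : fourierHat f ((2 * Real.pi) • η + (2 : ℝ) • ξ) = 0
      · simp [ha]
      · simp [hcon _ (-((2 * Real.pi) • η)) (by module) ha]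
  have h2 := wignerConvolution_two_smul f x ξ
  rw [hzero] at h2
  simp [h] at h2

lemma exists_wigner_ne_zero {f : EuclideanSpace ℝ (Fin d) → ℂ} (hi : Integrable f)
    {ξ : EuclideanSpace ℝ (Fin d)} (h : fourierHat f ξ ≠ 0) : ∃ x, wigner f x ξ ≠ 0 := by
  by_contra! hcon
  have hzero : wignerConvolution f ξ = 0 := by
    ext z
    have h2 : z = (2 : ℝ) • (1 / 2 : ℝ) • z := by module
    rw [h2, wignerConvolution_two_smul, hcon]
    simp
  -- At the frequency `-ξ/(2π)` the Fourier transform of the convolution is `|f̂ ξ|²`.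
  have h3 := fourier_wignerConvolution hi ξ (-(2 * Real.pi)⁻¹ • ξ)
  have h4 : (2 * Real.pi) • (-(2 * Real.pi)⁻¹ • ξ) = -ξ := by
    rw [smul_smul, mul_neg, mul_inv_cancel₀ (by positivity), neg_one_smul]
  have h5 : -ξ + (2 : ℝ) • ξ = ξ := by module
  rw [hzero, h4, neg_neg, h5, Real.fourier_eq'] at h3
  simp [h] at h3

/-! ### The sup norm and the support radius -/

lemma supNorm_nonneg (x : EuclideanSpace ℝ (Fin d)) : 0 ≤ supNorm x := norm_nonneg _

lemma continuous_supNorm :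
    Continuous (supNorm : EuclideanSpace ℝ (Fin d) → ℝ) :=
  (PiLp.continuous_ofLp 2 _).norm

lemma exists_norm_le_of_supNorm_le (r : ℝ) :
    ∃ B : ℝ, ∀ x : EuclideanSpace ℝ (Fin d), supNorm x ≤ r → ‖x‖ ≤ B := by
  have h := (PiLp.antilipschitzWith_ofLp 2 (fun _ : Fin d => ℝ)).isBounded_preimage
    (Metric.isBounded_closedBall (x := (0 : Fin d → ℝ)) (r := r))
  obtain ⟨B, hB⟩ := h.exists_norm_le
  exact ⟨B, fun x hx => hB x (by simpa [supNorm] using hx)⟩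

lemma supNorm_le_supportRadius_toReal {g : EuclideanSpace ℝ (Fin d) → ℂ}
    (hg : supportRadius g ≠ ∞) {x : EuclideanSpace ℝ (Fin d)} (hx : g x ≠ 0) :
    supNorm x ≤ (supportRadius g).toReal := by
  rw [← ENNReal.ofReal_le_iff_le_toReal hg]
  exact le_iSup₂ (f := fun x (_ : x ∈ tsupport g) => ENNReal.ofReal (supNorm x)) x
    (subset_tsupport g hx)

lemma exists_ne_zero_of_lt_supportRadius {g : EuclideanSpace ℝ (Fin d) → ℂ} {c : ℝ}
    (hc : ENNReal.ofReal c < supportRadius g) : ∃ x, g x ≠ 0 ∧ c < supNorm x := by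
  obtain ⟨x, hx⟩ := lt_iSup_iff.1 hc
  obtain ⟨hxs, hx⟩ := lt_iSup_iff.1 hx
  have hcx : c < supNorm x := by
    by_contra! h
    exact absurd hx (not_lt.2 (ENNReal.ofReal_le_ofReal h))
  obtain ⟨y, hy, hys⟩ := mem_closure_iff.1 hxs _
    (isOpen_lt continuous_const continuous_supNorm) hcx
  exact ⟨y, hys, hy⟩

/-! ### Estimates of mixed norms -/

lemma mixedNorm_mono_of_le_indicator {p q : ℝ≥0∞}
    {F : EuclideanSpace ℝ (Fin d) → EuclideanSpace ℝ (Fin d) → ℂ}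
    {φ : EuclideanSpace ℝ (Fin d) → ℝ} {S : Set (EuclideanSpace ℝ (Fin d))}
    (hS : ∀ x ξ, ξ ∈ S → ‖F x ξ‖ ≤ φ x) (hS' : ∀ x ξ, ξ ∉ S → F x ξ = 0) :
    mixedNorm p q F ≤ eLpNorm φ p volume * volume S ^ (1 / q.toReal) := by
  refine le_trans (eLpNorm_mono_enorm fun ξ => ?_)
    (eLpNorm_indicator_const_le (eLpNorm φ p volume) (s := S) q)
  by_cases hξ : ξ ∈ S
  · rw [Set.indicator_of_mem hξ]
    exact eLpNorm_mono_real fun x => hS x ξ hξ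
  · simp [hξ, hS']

lemma le_mixedNorm_of_le {p q : ℝ≥0∞} (hp : p ≠ 0) (hq : q ≠ 0)
    {F : EuclideanSpace ℝ (Fin d) → EuclideanSpace ℝ (Fin d) → ℂ} {c : ℝ} (hc : 0 ≤ c)
    {U V : Set (EuclideanSpace ℝ (Fin d))} (hU : IsOpen U) (hV : IsOpen V) (hU0 : U.Nonempty)
    (hV0 : V.Nonempty) (h : ∀ x ∈ U, ∀ ξ ∈ V, c ≤ ‖F x ξ‖) :
    ENNReal.ofReal c * (volume U ^ (1 / p.toReal) * volume V ^ (1 / q.toReal)) ≤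
      mixedNorm p q F := by
  rw [← mul_assoc, ← Real.enorm_of_nonneg hc, ← eLpNorm_indicator_const' hU.measurableSet
    (hU.measure_pos volume hU0).ne' hp]
  rw [← enorm_eq_self (eLpNorm (U.indicator fun _ => c) p volume),
    ← eLpNorm_indicator_const' hV.measurableSet (hV.measure_pos volume hV0).ne' hq]
  refine eLpNorm_mono_enorm fun ξ => ?_
  by_cases hξ : ξ ∈ V
  · rw [Set.indicator_of_mem hξ]
    refine eLpNorm_mono fun x => ?_
    by_cases hx : x ∈ U
    · rw [Set.indicator_of_mem hx, Real.norm_of_nonneg hc]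
      exact h x hx ξ hξ
    · simp [hx]
  · simp [hξ]

lemma eLpNorm_one_add_norm_rpow_lt_top {p : ℝ≥0∞} (hp : 1 ≤ p) :
    eLpNorm (fun x : EuclideanSpace ℝ (Fin d) => (1 + ‖x‖) ^ (-((d : ℝ) + 1))) p volume < ∞ := by
  have hle (x : EuclideanSpace ℝ (Fin d)) : (1 + ‖x‖) ^ (-((d : ℝ) + 1)) ≤ 1 :=
    Real.rpow_le_one_of_one_le_of_nonpos (by linarith [norm_nonneg x])
      (by linarith [(d.cast_nonneg : (0 : ℝ) ≤ d)])
  have hnn (x : EuclideanSpace ℝ (Fin d)) : 0 ≤ (1 + ‖x‖) ^ (-((d : ℝ) + 1)) := by positivity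
  have henorm (x : EuclideanSpace ℝ (Fin d)) : ‖(1 + ‖x‖) ^ (-((d : ℝ) + 1))‖ₑ ≤ 1 := by
    rw [Real.enorm_of_nonneg (hnn x)]
    exact ENNReal.ofReal_le_one.2 (hle x)
  rcases eq_or_ne p ∞ with rfl | hpt
  · rw [eLpNorm_exponent_top]
    exact (eLpNormEssSup_le_of_ae_enorm_bound (ae_of_all _ henorm)).trans_lt ENNReal.one_lt_top
  · rw [eLpNorm_lt_top_iff_lintegral_rpow_enorm_lt_top (by positivity) hpt]
    refine lt_of_le_of_lt (lintegral_mono fun x => ?_) integrable_one_add_norm_rpow.2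
    exact ENNReal.rpow_le_self_of_le_one (henorm x) (by simpa using ENNReal.toReal_mono hpt hp)

/-! ### Limits of roots -/

lemma tendsto_rpow_one_div_natCast {K : ℝ≥0∞} (h0 : K ≠ 0) (ht : K ≠ ∞) :
    Tendsto (fun N : ℕ => K ^ (1 / (N : ℝ))) atTop (𝓝 1) := by
  have h : (fun N : ℕ => K ^ (1 / (N : ℝ))) =
      fun N : ℕ => ENNReal.ofReal (K.toReal ^ (1 / (N : ℝ))) := by
    ext N
    rw [← ENNReal.ofReal_rpow_of_pos (ENNReal.toReal_pos h0 ht), ENNReal.ofReal_toReal ht]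
  have hlim := (tendsto_const_nhds (x := K.toReal)).rpow tendsto_one_div_atTop_nhds_zero_nat
    (Or.inl (ENNReal.toReal_pos h0 ht).ne')
  rw [Real.rpow_zero] at hlim
  rw [h, ← ENNReal.ofReal_one]
  exact ENNReal.tendsto_ofReal hlim

lemma tendsto_pow_mul_rpow_one_div {c K : ℝ≥0∞} (h0 : K ≠ 0) (ht : K ≠ ∞) :
    Tendsto (fun N : ℕ => (c ^ N * K) ^ (1 / (N : ℝ))) atTop (𝓝 c) := by
  have h := ENNReal.Tendsto.const_mul (a := c) (tendsto_rpow_one_div_natCast h0 ht)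
    (Or.inl one_ne_zero)
  rw [mul_one] at h
  refine h.congr' ?_
  filter_upwards [eventually_ne_atTop 0] with N hN
  rw [ENNReal.mul_rpow_of_nonneg _ _ (by positivity), ← ENNReal.rpow_natCast, ← ENNReal.rpow_mul,
    mul_one_div_cancel (by positivity), ENNReal.rpow_one]

/-- Comparison with geometric sequences determines the limit of the `N`-th roots. The constants
`K` need not be uniform in `c`. -/
lemma tendsto_rpow_one_div_of_bounds {u : ℕ → ℝ≥0∞} {R : ℝ≥0∞}
    (hlow : ∀ c : ℝ, 0 ≤ c → ENNReal.ofReal c < R →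
      ∃ K : ℝ≥0∞, K ≠ 0 ∧ ∀ N, ENNReal.ofReal c ^ N * K ≤ u N)
    (hup : R ≠ ∞ → ∃ K : ℝ≥0∞, K ≠ ∞ ∧ ∀ N, u N ≤ R ^ N * K) :
    Tendsto (fun N : ℕ => u N ^ (1 / (N : ℝ))) atTop (𝓝 R) := by
  refine tendsto_order.2 ⟨fun a ha => ?_, fun a ha => ?_⟩
  · obtain ⟨c, hac, hcR⟩ := exists_between ha
    have hct : c ≠ ∞ := hcR.ne_top
    rw [← ENNReal.ofReal_toReal hct] at hcR
    obtain ⟨K, hK0, hK⟩ := hlow c.toReal ENNReal.toReal_nonneg hcR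
    rw [ENNReal.ofReal_toReal hct] at hK
    have hlim := tendsto_pow_mul_rpow_one_div (c := c) (K := min K 1)
      (by simp [hK0]) (by simp)
    filter_upwards [hlim.eventually (lt_mem_nhds hac)] with N hN
    refine hN.trans_le (ENNReal.rpow_le_rpow (le_trans ?_ (hK N)) (by positivity))
    gcongr
    exact min_le_left _ _
  · obtain ⟨K, hKt, hK⟩ := hup ha.ne_top
    have hlim := tendsto_pow_mul_rpow_one_div (c := R) (K := max K 1)
      (by simp) (by simp [hKt])
    filter_upwards [hlim.eventually (gt_mem_nhds ha)] with N hN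
    refine lt_of_le_of_lt (ENNReal.rpow_le_rpow ((hK N).trans ?_) (by positivity)) hN
    gcongr
    exact le_max_left _ _

/-! ### The weighted Wigner transform -/

/-- The function whose mixed norm is studied: the Wigner transform multiplied by the exponential
weights and by `|ξ|_∞ ^ N`. -/
noncomputable def weightedWigner (ω : ℝ → ℝ) (f : EuclideanSpace ℝ (Fin d) → ℂ) (lam mu : ℝ)
    (N : ℕ) (x ξ : EuclideanSpace ℝ (Fin d)) : ℂ :=
  ((Real.exp (lam * ω ‖((N : ℝ) + 1)⁻¹ • x‖ + mu * ω ‖ξ‖) * supNorm ξ ^ N : ℝ) : ℂ) * wigner f x ξ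

lemma norm_weightedWigner (ω : ℝ → ℝ) (f : EuclideanSpace ℝ (Fin d) → ℂ) (lam mu : ℝ)
    (N : ℕ) (x ξ : EuclideanSpace ℝ (Fin d)) :
    ‖weightedWigner ω f lam mu N x ξ‖ =
      Real.exp (lam * ω ‖((N : ℝ) + 1)⁻¹ • x‖) * Real.exp (mu * ω ‖ξ‖) * supNorm ξ ^ N *
        ‖wigner f x ξ‖ := by
  have := supNorm_nonneg ξ
  rw [weightedWigner, norm_mul, Complex.norm_real, Real.norm_of_nonneg (by positivity),
    Real.exp_add]

/-- Lower bound: the frequencies with `|ξ|_∞ > c` at which the Fourier transform of `f` does not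
vanish contribute a fixed positive amount to the mixed norm. -/
lemma MemSomega.exists_mul_le_mixedNorm {ω : ℝ → ℝ} (hω : IsNonQuasianalyticWeight ω)
    {f : EuclideanSpace ℝ (Fin d) → ℂ} (hf : MemSomega ω f) {p q : ℝ≥0∞} (hp : 1 ≤ p)
    (hq : 1 ≤ q) {lam mu : ℝ} (hlam : 0 ≤ lam) (hmu : 0 ≤ mu) {c : ℝ} (hc0 : 0 ≤ c)
    (hc : ENNReal.ofReal c < supportRadius (fourierHat f)) :
    ∃ K : ℝ≥0∞, K ≠ 0 ∧ ∀ N : ℕ,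
      ENNReal.ofReal c ^ N * K ≤ mixedNorm p q (weightedWigner ω f lam mu N) := by
  obtain ⟨ξ₀, hξ₀, hcξ⟩ := exists_ne_zero_of_lt_supportRadius hc
  obtain ⟨x₀, hx₀⟩ := exists_wigner_ne_zero hf.integrable hξ₀
  set δ := ‖wigner f x₀ ξ₀‖ / 2 with hδ
  have hδ0 : 0 < δ := by positivity
  -- By continuity `|Wig f| > δ` on a box `U ×ˢ V`, and `V` can be taken inside `{|ξ|_∞ > c}`.
  have hopen : {z : EuclideanSpace ℝ (Fin d) × EuclideanSpace ℝ (Fin d) |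
      δ < ‖wigner f z.1 z.2‖ ∧ c < supNorm z.2} ∈ 𝓝 (x₀, ξ₀) := by
    refine IsOpen.mem_nhds ((isOpen_lt continuous_const (hf.continuous_wigner hω).norm).inter
      (isOpen_lt continuous_const (continuous_supNorm.comp continuous_snd)))
      ⟨half_lt_self (norm_pos_iff.2 hx₀), hcξ⟩
  obtain ⟨U, V, hU, hxU, hV, hξV, hUV⟩ := mem_nhds_prod_iff'.1 hopen
  refine ⟨ENNReal.ofReal δ * (volume U ^ (1 / p.toReal) * volume V ^ (1 / q.toReal)), ?_,
    fun N => ?_⟩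
  · have hU0 := (hU.measure_pos volume ⟨x₀, hxU⟩).ne'
    have hV0 := (hV.measure_pos volume ⟨ξ₀, hξV⟩).ne'
    simp [ENNReal.rpow_eq_zero_iff, hU0, hV0, hδ0]
  · rw [← mul_assoc, ← ENNReal.ofReal_pow hc0, ← ENNReal.ofReal_mul (by positivity)]
    refine le_mixedNorm_of_le (by positivity) (by positivity) (by positivity) hU hV ⟨x₀, hxU⟩
      ⟨ξ₀, hξV⟩ fun x hx ξ hξ => ?_
    obtain ⟨h1, h2⟩ := hUV (Set.mk_mem_prod hx hξ)
    rw [norm_weightedWigner]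
    have e1 : 1 ≤ Real.exp (lam * ω ‖((N : ℝ) + 1)⁻¹ • x‖) :=
      Real.one_le_exp (mul_nonneg hlam (hω.nonneg _ (norm_nonneg _)))
    have e2 : 1 ≤ Real.exp (mu * ω ‖ξ‖) :=
      Real.one_le_exp (mul_nonneg hmu (hω.nonneg _ (norm_nonneg _)))
    have e3 : c ^ N ≤ supNorm ξ ^ N := pow_le_pow_left₀ hc0 h2.le N
    have e4 : c ^ N ≤ Real.exp (lam * ω ‖((N : ℝ) + 1)⁻¹ • x‖) * Real.exp (mu * ω ‖ξ‖) *
        supNorm ξ ^ N :=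
      e3.trans (le_mul_of_one_le_left (pow_nonneg (supNorm_nonneg ξ) N)
        (one_le_mul_of_one_le_of_one_le e1 e2))
    exact mul_le_mul e4 h1.le hδ0.le ((pow_nonneg hc0 N).trans e4)

/-- Upper bound: the Wigner transform lives on the bounded set `{|ξ|_∞ ≤ R}`, where `ω(|ξ|)` is
bounded, and its decay in `x` absorbs the weight uniformly in `N`. -/
lemma MemSomega.exists_mixedNorm_le {ω : ℝ → ℝ} (hω : IsNonQuasianalyticWeight ω)
    {f : EuclideanSpace ℝ (Fin d) → ℂ} (hf : MemSomega ω f) {p q : ℝ≥0∞} (hp : 1 ≤ p)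
    {lam mu : ℝ} (hlam : 0 ≤ lam) (hmu : 0 ≤ mu)
    (hR : supportRadius (fourierHat f) ≠ ∞) :
    ∃ K : ℝ≥0∞, K ≠ ∞ ∧ ∀ N : ℕ,
      mixedNorm p q (weightedWigner ω f lam mu N) ≤ supportRadius (fourierHat f) ^ N * K := by
  set r := (supportRadius (fourierHat f)).toReal with hr
  have hr0 : 0 ≤ r := ENNReal.toReal_nonneg
  obtain ⟨B, hB⟩ := exists_norm_le_of_supNorm_le (d := d) r
  obtain ⟨C, hC0, hC⟩ := hf.exists_decay_wigner hω hlam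
  set S := {ξ : EuclideanSpace ℝ (Fin d) | supNorm ξ ≤ r} with hS
  set M := Real.exp (mu * ω B) with hM
  have hSfin : volume S ≠ ∞ := by
    refine ((measure_mono fun ξ hξ => ?_).trans_lt
      (measure_closedBall_lt_top (x := (0 : EuclideanSpace ℝ (Fin d))) (r := B))).ne
    simpa using hB ξ hξ
  obtain ⟨Cf, hCf⟩ : ∃ Cf, ∀ y, ‖f y‖ ≤ Cf := by
    obtain ⟨Cf, hCf⟩ := hf.decay 1 one_pos 0
    rw [Dmulti_zero] at hCf
    refine ⟨Cf, fun y => le_trans ?_ (hCf y)⟩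
    exact le_mul_of_one_le_left (norm_nonneg _)
      (Real.one_le_exp (mul_nonneg zero_le_one (hω.nonneg _ (norm_nonneg y))))
  have hsupp : ∀ x ξ, ξ ∉ S → wigner f x ξ = 0 := by
    intro x ξ hξ
    by_contra hne
    obtain ⟨a, b, hab, ha, hb⟩ :=
      exists_midpoint_of_wigner_ne_zero hf.integrable hf.smooth.continuous hCf hne
    refine hξ ?_
    have ha' := supNorm_le_supportRadius_toReal hR ha
    have hb' := supNorm_le_supportRadius_toReal hR hb
    have h2 : 2 * supNorm ξ = ‖WithLp.ofLp a + WithLp.ofLp b‖ := by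
      rw [← WithLp.ofLp_add, hab, WithLp.ofLp_smul, norm_smul, supNorm]
      norm_num
    have h3 : ‖WithLp.ofLp a + WithLp.ofLp b‖ ≤ supNorm a + supNorm b := norm_add_le _ _
    change supNorm ξ ≤ r
    linarith
  refine ⟨ENNReal.ofReal (M * C) * eLpNorm (fun x : EuclideanSpace ℝ (Fin d) =>
    (1 + ‖x‖) ^ (-((d : ℝ) + 1))) p volume * volume S ^ (1 / q.toReal), ?_, fun N => ?_⟩
  · exact ENNReal.mul_ne_top (ENNReal.mul_ne_top ENNReal.ofReal_ne_top
      (eLpNorm_one_add_norm_rpow_lt_top hp).ne) (ENNReal.rpow_ne_top_of_nonneg (by positivity) hSfin)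
  · refine (mixedNorm_mono_of_le_indicator (S := S)
      (φ := (r ^ N * (M * C)) • fun x : EuclideanSpace ℝ (Fin d) =>
        (1 + ‖x‖) ^ (-((d : ℝ) + 1))) ?_ ?_).trans_eq ?_
    · intro x ξ hξ
      rw [norm_weightedWigner]
      have e1 : Real.exp (lam * ω ‖((N : ℝ) + 1)⁻¹ • x‖) ≤ Real.exp (lam * ω ‖x‖) := by
        refine Real.exp_le_exp.2 (mul_le_mul_of_nonneg_left
          (hω.monotoneOn (norm_nonneg _) (norm_nonneg _) ?_) hlam)
        rw [norm_smul, Real.norm_of_nonneg (by positivity)]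
        exact mul_le_of_le_one_left (norm_nonneg x)
          (inv_le_one_of_one_le₀ (by linarith [(N.cast_nonneg : (0 : ℝ) ≤ N)]))
      have e2 : Real.exp (mu * ω ‖ξ‖) ≤ M :=
        Real.exp_le_exp.2 (mul_le_mul_of_nonneg_left
          (hω.monotoneOn (norm_nonneg _) ((norm_nonneg ξ).trans (hB ξ hξ)) (hB ξ hξ)) hmu)
      have e3 : supNorm ξ ^ N ≤ r ^ N := pow_le_pow_left₀ (supNorm_nonneg ξ) hξ N
      have e0 := pow_nonneg (supNorm_nonneg ξ) N
      calc _ ≤ Real.exp (lam * ω ‖x‖) * M * r ^ N * ‖wigner f x ξ‖ := by gcongr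
        _ = r ^ N * M * (Real.exp (lam * ω ‖x‖) * ‖wigner f x ξ‖) := by ring
        _ ≤ r ^ N * M * (C * (1 + ‖x‖) ^ (-((d : ℝ) + 1))) := by
          exact mul_le_mul_of_nonneg_left (hC x ξ) (by positivity)
        _ = _ := by
          rw [Pi.smul_apply, smul_eq_mul]
          ring
    · intro x ξ hξ
      simp [weightedWigner, hsupp x ξ hξ]
    · rw [eLpNorm_const_smul, Real.enorm_of_nonneg (by positivity),
        ENNReal.ofReal_mul (by positivity), ENNReal.ofReal_pow hr0, hr, ENNReal.ofReal_toReal hR]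
      ring

end PaleyWienerWigner

theorem corollary3p10 {d : ℕ} (ω : ℝ → ℝ)
    (hω : PaleyWienerWigner.IsNonQuasianalyticWeight ω)
    (f : EuclideanSpace ℝ (Fin d) → ℂ) (hf : PaleyWienerWigner.MemSomega ω f)
    (p q : ℝ≥0∞) (hp : 1 ≤ p) (hq : 1 ≤ q)
    (lam mu : ℝ) (hlam : 0 ≤ lam) (hmu : 0 ≤ mu) :
    Tendsto
      (fun N : ℕ =>
        (PaleyWienerWigner.mixedNorm p q (fun x ξ =>
          ((Real.exp (lam * ω ‖((N : ℝ) + 1)⁻¹ • x‖ + mu * ω ‖ξ‖) *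
            PaleyWienerWigner.supNorm ξ ^ N : ℝ) : ℂ) *
              PaleyWienerWigner.wigner f x ξ)) ^ (1 / (N : ℝ)))
      atTop (𝓝 (PaleyWienerWigner.supportRadius (PaleyWienerWigner.fourierHat f))) :=
  PaleyWienerWigner.tendsto_rpow_one_div_of_bounds
    (fun _ hc0 hc => hf.exists_mul_le_mixedNorm hω hp hq hlam hmu hc0 hc)
    (fun hR => hf.exists_mixedNorm_le hω hp hlam hmu hR)
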